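/- Let $n\ge 1$. Write $B_r=\{x\in\mathbb R^{n+1}:|x|\le r\}$ and $U_r=\{x\in\mathbb R^{n+1}:|x|<r\}$, let $\mathcal L^{n+1}$ be Lebesgue measure and $\mathcal H^n$ the $n$-dimensional Hausdorff measure on $\mathbb R^{n+1}$. A weight is a function $\Omega\in C^2(\mathbb R^{n+1})$ such that, for some constant $c_1\ge 0$, $0<\Omega\le 1$, $|\nabla\Omega|\le c_1\Omega$ and $\|\nabla^2\Omega\|\le c_1\Omega$ on $\mathbb R^{n+1}$. An $\Omega$-finite open partition of $N$ elements is an ordered family $\mathcal E=\{E_i\}_{i=1}^N$ of mutually disjoint open sets in $\mathbb R^{n+1}$ such that $\int_{\mathbb R^{n+1}\setminus\bigcup_i E_i}\Omega\,d\mathcal H^n<\infty$ and $\bigcup_i\partial E_i$ is countably $n$-rectifiable (covered, up to an $\mathcal H^n$-null set, by countably many Lipschitz images of $\mathbb R^n$). For any finite family $\mathcal E=\{E_i\}_{i=1}^N$ of open sets, $\|\partial\mathcal E\|$ denotes the restriction of $\mathcal H^n$ to $\bigcup_i\partial E_i$. For $f:\mathbb R^{n+1}\to\mathbb R^{n+1}$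 put $\tilde E_i=\operatorname{int} f(E_i)$ and $f_\star\mathcal E=\{\tilde E_i\}_{i=1}^N$. The map $f$ is $\mathcal E$-admissible if it is Lipschitz, the sets $\tilde E_i$ are mutually disjoint, $\mathbb R^{n+1}\setminus\bigcup_i\tilde E_i\subset f\big(\bigcup_i\partial E_i\big)$, and $\sup_x|f(x)-x|<\infty$. Then there exist constants $c_2,c_3\in(0,\infty)$ depending only on $n$ with the following property. Let $\Omega$ be a weight, $N\in\mathbb N$, $\mathcal E=\{E_i\}_{i=1}^N$ an $\Omega$-finite open partition and $R>0$, and suppose that $0\in\operatorname{spt}\|\partial\mathcal E\|$ and $\|\partial\mathcal E\|(B_R)\le c_2R^n$. Then there exist an $\mathcal E$-admissible function $f$ and $r\in[\frac R2,R]$ such that 1. $f(x)=x$ for all $x\in\mathbb R^{n+1}\setminus U_r$; 2. $f(x)\in B_r$ for all $x\in B_r$; 3. $\|\partial f_\star\mathcal E\|(B_r)\le\frac12\|\partial\mathcal E\|(B_r)$; 4. $\mathcal L^{n+1}(E_i\triangle\tilde E_i)\le c_3\,\big(\|\partial\mathcal E\|(B_r)\big)^{\frac{n+1}{n}}$ for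 all $i=1,\dots,N$. -/

import Mathlib

open MeasureTheory Set
open scoped ENNReal NNReal MeasureTheory

namespace OpenPartition

/-- Euclidean space `ℝ^m`. -/
abbrev Euc (m : ℕ) : Type := EuclideanSpace ℝ (Fin m)

/-- The `n`-dimensional Hausdorff measure on `ℝ^m` in the usual normalization, i.e. with the factor
`ω_n / 2^n`, where `ω_n` is the volume of the unit ball of `ℝ^n` (Mathlib's `μH[n]` is built from
`diam ^ n` without a factor). -/
noncomputable def hausdorff (n m : ℕ) : Measure (Euc m) :=
  (volume (Metric.ball (0 : Euc n) 1) / 2 ^ n) • μH[(n : ℝ)]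

/-- Countably `n`-rectifiable subsets of `ℝ^m`: up to an `ℋⁿ`-null set, covered by countably many
Lipschitz images of `ℝ^n`. -/
def IsCountablyRectifiable (n m : ℕ) (S : Set (Euc m)) : Prop :=
  ∃ g : ℕ → Euc n → Euc m, (∀ k, ∃ K : ℝ≥0, LipschitzWith K (g k)) ∧
    hausdorff n m (S \ ⋃ k, range (g k)) = 0

/-- Weight functions: `Ω ∈ C²` with `0 < Ω ≤ 1`, `|∇Ω| ≤ c₁ Ω` and `‖∇²Ω‖ ≤ c₁ Ω` for a
constant `c₁ ≥ 0`. -/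
def IsWeight {m : ℕ} (Ω : Euc m → ℝ) : Prop :=
  ContDiff ℝ 2 Ω ∧ (∀ x, 0 < Ω x ∧ Ω x ≤ 1) ∧
    ∃ c₁ : ℝ, 0 ≤ c₁ ∧ ∀ x, ‖fderiv ℝ Ω x‖ ≤ c₁ * Ω x ∧
      ‖fderiv ℝ (fderiv ℝ Ω) x‖ ≤ c₁ * Ω x

/-- `⋃ᵢ ∂Eᵢ`, the union of the topological boundaries. -/
def bdry {m N : ℕ} (E : Fin N → Set (Euc m)) : Set (Euc m) :=
  ⋃ i, frontier (E i)

/-- `E = {E₁, …, E_N}` is an `Ω`-finite open partition of `ℝ^{n+1}`. -/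
structure IsOpenPartition {n N : ℕ} (Ω : Euc (n + 1) → ℝ) (E : Fin N → Set (Euc (n + 1))) :
    Prop where
  isOpen : ∀ i, IsOpen (E i)
  disjoint : ∀ i j, i ≠ j → Disjoint (E i) (E j)
  finite : ((hausdorff n (n + 1)).withDensity fun x => ENNReal.ofReal (Ω x)) (⋃ i, E i)ᶜ < ∞
  rectifiable : IsCountablyRectifiable n (n + 1) (bdry E)

/-- The weight measure `‖∂E‖ = ℋⁿ⌊(⋃ᵢ ∂Eᵢ)` of the unit density varifold `|⋃ᵢ ∂Eᵢ|`. -/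
noncomputable def bdryMeasure {n N : ℕ} (E : Fin N → Set (Euc (n + 1))) : Measure (Euc (n + 1)) :=
  (hausdorff n (n + 1)).restrict (bdry E)

/-- The push-forward `f⋆E`, whose cells are the interiors of the sets `f(Eᵢ)`. -/
def push {m N : ℕ} (f : Euc m → Euc m) (E : Fin N → Set (Euc m)) : Fin N → Set (Euc m) :=
  fun i => interior (f '' E i)

/-- `E`-admissible functions. -/
structure IsAdmissible {m N : ℕ} (E : Fin N → Set (Euc m)) (f : Euc m → Euc m) : Prop where
  lipschitz : ∃ K : ℝ≥0, LipschitzWith K f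
  disjoint : ∀ i j, i ≠ j → Disjoint (push f E i) (push f E j)
  compl_subset : (⋃ i, push f E i)ᶜ ⊆ f '' bdry E
  displacement : ∃ C : ℝ, ∀ x, ‖f x - x‖ ≤ C

end OpenPartition

open OpenPartition

namespace OpenPartition

/-! ### A relative isoperimetric inequality in the unit cube -/

/-- The unit cube `[0,1]^ι`. -/
def unitCube (ι : Type*) : Set (ι → ℝ) := univ.pi fun _ => Icc (0 : ℝ) 1

/-- The points of the unit cube whose segment in the `j`-th direction meets `S`. -/
def axisShadow {ι : Type*} [DecidableEq ι] (j : ι) (S : Set (ι → ℝ)) : Set (ι → ℝ) :=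
  {x ∈ unitCube ι | ∃ t ∈ Icc (0 : ℝ) 1, Function.update x j t ∈ S}

/-- Lebesgue measure on the unit interval. -/
noncomputable abbrev unitMeasure : Measure ℝ := volume.restrict (Icc (0 : ℝ) 1)

instance isProbabilityMeasure_unitMeasure : IsProbabilityMeasure unitMeasure :=
  ⟨by simp [unitMeasure]⟩

lemma pi_unitMeasure (ι : Type*) [Fintype ι] :
    Measure.pi (fun _ : ι => unitMeasure) = volume.restrict (unitCube ι) := by
  rw [unitCube, volume_pi, Measure.restrict_pi_pi]

lemma isCompact_unitCube (ι : Type*) : IsCompact (unitCube ι) :=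
  isCompact_univ_pi fun _ => isCompact_Icc

lemma update_mem_unitCube {ι : Type*} [DecidableEq ι] {x : ι → ℝ} (hx : x ∈ unitCube ι) (j : ι)
    {t : ℝ} (ht : t ∈ Icc (0 : ℝ) 1) : Function.update x j t ∈ unitCube ι := by
  intro i _
  by_cases h : i = j
  · subst h; simpa using ht
  · simpa [h] using hx i (mem_univ i)

/-- Mixing the coordinates of two independent points with the same product law gives that law. -/
lemma measurePreserving_mix {ι α : Type*} [Fintype ι] [MeasurableSpace α] (ν : ι → Measure α)
    [∀ i, IsProbabilityMeasure (ν i)] (p : ι → Prop) [DecidablePred p] :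
    MeasurePreserving (fun (q : (ι → α) × (ι → α)) i => if p i then q.2 i else q.1 i)
      ((Measure.pi ν).prod (Measure.pi ν)) (Measure.pi ν) := by
  have hm : Measurable (fun (q : (ι → α) × (ι → α)) i => if p i then q.2 i else q.1 i) := by
    refine measurable_pi_lambda _ fun i => ?_
    by_cases h : p i
    · simp only [h, if_true]; fun_prop
    · simp only [h, if_false]; fun_prop
  refine ⟨hm, (Measure.pi_eq fun s hs => ?_).symm⟩
  rw [Measure.map_apply hm (MeasurableSet.univ_pi hs)]
  have : (fun (q : (ι → α) × (ι → α)) i => if p i then q.2 i else q.1 i) ⁻¹' (univ.pi s) =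
      (univ.pi fun i => if p i then univ else s i) ×ˢ
        (univ.pi fun i => if p i then s i else univ) := by
    ext q
    simp only [mem_preimage, mem_pi, mem_univ, true_imp_iff, mem_prod, ← forall_and]
    refine forall_congr' fun i => ?_
    by_cases h : p i <;> simp [h]
  rw [this, Measure.prod_prod, Measure.pi_pi, Measure.pi_pi, ← Finset.prod_mul_distrib]
  refine Finset.prod_congr rfl fun i _ => ?_
  by_cases h : p i <;> simp [h]

/-- If cells cannot change along axis segments outside their shadows, then two points all of
whose coordinate mixtures avoid the shadows lie in the same cell. -/
lemma mem_cell_of_chain {m N : ℕ} {E : Fin N → Set (Fin m → ℝ)} {S : Set (Fin m → ℝ)}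
    (hcell : ∀ j, ∀ x ∈ unitCube (Fin m), x ∉ axisShadow j S →
      ∀ i, x ∈ E i → ∀ t ∈ Icc (0 : ℝ) 1, Function.update x j t ∈ E i)
    {x y : Fin m → ℝ} (hx : x ∈ unitCube (Fin m)) (hy : y ∈ unitCube (Fin m))
    (h : ∀ k : Fin m, (fun i => if i < k then y i else x i) ∉ axisShadow k S)
    {i : Fin N} (hi : x ∈ E i) : y ∈ E i := by
  have key : ∀ k : ℕ, k ≤ m → (fun l : Fin m => if l.val < k then y l else x l) ∈ E i := by
    intro k
    induction k with
    | zero => intro _; simpa using hi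
    | succ k ih =>
      intro hk
      have h1 := ih (by omega)
      have hQ : (fun l : Fin m => if l.val < k then y l else x l) ∈ unitCube (Fin m) := by
        intro l _
        by_cases hl : l.val < k
        · simpa [hl] using hy l (mem_univ l)
        · simpa [hl] using hx l (mem_univ l)
      have h2 := hcell ⟨k, hk⟩ _ hQ (h ⟨k, hk⟩) i h1 (y ⟨k, hk⟩) (hy _ (mem_univ _))
      convert h2 using 1
      ext l
      by_cases hl : l = ⟨k, hk⟩
      · subst hl; simp
      · have : l.val ≠ k := fun h => hl (Fin.ext h)
        rw [Function.update_of_ne hl]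
        have : l.val < k + 1 ↔ l.val < k := by omega
        simp [this]
  have := key m le_rfl
  simpa using this

/-- The linear relative isoperimetric inequality in the cube: one cell contains everything up to
the total measure of the shadows. -/
lemma exists_cell_compl_le {m N : ℕ} (hm : 0 < m) (hN : 0 < N) {E : Fin N → Set (Fin m → ℝ)}
    (hE : ∀ i, MeasurableSet (E i)) (hd : Pairwise fun i j => Disjoint (E i) (E j))
    {S : Set (Fin m → ℝ)} (hS : (⋃ i, E i)ᶜ ∩ unitCube (Fin m) ⊆ S)
    (hSm : ∀ j, MeasurableSet (axisShadow j S))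
    (hcell : ∀ j, ∀ x ∈ unitCube (Fin m), x ∉ axisShadow j S →
      ∀ i, x ∈ E i → ∀ t ∈ Icc (0 : ℝ) 1, Function.update x j t ∈ E i) :
    ∃ i, Measure.pi (fun _ : Fin m => unitMeasure) (E i)ᶜ ≤
      ∑ j, Measure.pi (fun _ : Fin m => unitMeasure) (axisShadow j S) := by
  set μ := Measure.pi (fun _ : Fin m => unitMeasure) with hμ
  have hQ : μ (unitCube (Fin m))ᶜ = 0 := by
    rw [hμ, pi_unitMeasure, Measure.restrict_apply
      (isCompact_unitCube _).isClosed.measurableSet.compl]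
    simp
  let mix : Fin m → (Fin m → ℝ) × (Fin m → ℝ) → Fin m → ℝ :=
    fun k q i => if i < k then q.2 i else q.1 i
  have hmix : ∀ k, MeasurePreserving (mix k) (μ.prod μ) μ := fun k =>
    measurePreserving_mix (fun _ : Fin m => unitMeasure) (fun i => i < k)
  have hcover : (univ : Set ((Fin m → ℝ) × (Fin m → ℝ))) ⊆
      ((⋃ i, E i ×ˢ E i) ∪ ⋃ k, mix k ⁻¹' axisShadow k S) ∪
        ((unitCube (Fin m))ᶜ ×ˢ univ ∪ univ ×ˢ (unitCube (Fin m))ᶜ) := by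
    rintro ⟨x, y⟩ -
    by_cases hx : x ∈ unitCube (Fin m)
    swap
    · exact Or.inr (Or.inl ⟨hx, mem_univ _⟩)
    by_cases hy : y ∈ unitCube (Fin m)
    swap
    · exact Or.inr (Or.inr ⟨mem_univ _, hy⟩)
    left
    by_cases h : ∃ k, mix k (x, y) ∈ axisShadow k S
    · obtain ⟨k, hk⟩ := h
      exact Or.inr (mem_iUnion.2 ⟨k, hk⟩)
    push Not at h
    left
    have hxE : ∃ i, x ∈ E i := by
      by_contra hc
      refine h ⟨0, hm⟩ ?_
      have : mix ⟨0, hm⟩ (x, y) = x := by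
        ext i
        have : ¬ i < (⟨0, hm⟩ : Fin m) := by simp [Fin.lt_def]
        simp [mix, this]
      rw [this]
      refine ⟨hx, x ⟨0, hm⟩, hx _ (mem_univ _), ?_⟩
      rw [Function.update_eq_self]
      exact hS ⟨by simpa using hc, hx⟩
    obtain ⟨i, hi⟩ := hxE
    exact mem_iUnion.2 ⟨i, hi, mem_cell_of_chain hcell hx hy h hi⟩
  have h1 : 1 ≤ ∑ i, μ (E i) * μ (E i) + ∑ k, μ (axisShadow k S) := by
    calc (1 : ℝ≥0∞) = (μ.prod μ) univ := by simp
      _ ≤ _ := measure_mono hcover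
      _ ≤ ((μ.prod μ) (⋃ i, E i ×ˢ E i) + (μ.prod μ) (⋃ k, mix k ⁻¹' axisShadow k S)) +
          ((μ.prod μ) ((unitCube (Fin m))ᶜ ×ˢ univ) + (μ.prod μ) (univ ×ˢ (unitCube (Fin m))ᶜ)) :=
        (measure_union_le _ _).trans (add_le_add (measure_union_le _ _) (measure_union_le _ _))
      _ ≤ (∑ i, μ (E i) * μ (E i) + ∑ k, μ (axisShadow k S)) + (0 + 0) := by
        gcongr
        · refine (measure_iUnion_fintype_le _ _).trans (le_of_eq ?_)
          simp [Measure.prod_prod]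
        · refine (measure_iUnion_fintype_le _ _).trans (le_of_eq ?_)
          exact Finset.sum_congr rfl fun k _ =>
            (hmix k).measure_preimage (hSm k).nullMeasurableSet
        · rw [Measure.prod_prod, hQ, zero_mul]
        · rw [Measure.prod_prod, hQ, mul_zero]
      _ = _ := by simp
  have : Nonempty (Fin N) := ⟨⟨0, hN⟩⟩
  obtain ⟨i, -, hi⟩ := Finset.exists_max_image Finset.univ (fun i => μ (E i))
    Finset.univ_nonempty
  refine ⟨i, ?_⟩
  rw [prob_compl_eq_one_sub (hE i), tsub_le_iff_left]
  refine h1.trans ?_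
  gcongr
  calc ∑ k, μ (E k) * μ (E k) ≤ ∑ k, μ (E i) * μ (E k) := by
        exact Finset.sum_le_sum fun k hk => mul_le_mul_left (hi k hk) _
    _ = μ (E i) * μ (⋃ k, E k) := by
        rw [← Finset.mul_sum, measure_iUnion hd hE, tsum_fintype]
    _ ≤ μ (E i) * 1 := by gcongr; exact prob_le_one
    _ = μ (E i) := mul_one _

lemma isClosed_axisShadow {n : ℕ} (j : Fin n) {S : Set (Fin n → ℝ)} (hS : IsClosed S) :
    IsClosed (axisShadow j S) := by
  have : axisShadow j S = unitCube (Fin n) ∩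
      Prod.fst '' ({q : (Fin n → ℝ) × Icc (0 : ℝ) 1 | Function.update q.1 j (q.2 : ℝ) ∈ S}) := by
    ext x
    simp [axisShadow]
  rw [this]
  refine (isCompact_unitCube _).isClosed.inter (isClosedMap_fst_of_compactSpace _ ?_)
  exact hS.preimage (continuous_fst.update j (continuous_subtype_val.comp continuous_snd))

/-- The measure of a shadow is at most that of the projection along the axis. -/
lemma pi_axisShadow_le {n : ℕ} (j : Fin (n + 1)) {S : Set (Fin (n + 1) → ℝ)} (hS : IsCompact S) :
    Measure.pi (fun _ : Fin (n + 1) => unitMeasure) (axisShadow j S) ≤ μH[(n : ℝ)] S := by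
  let A : Set (Fin n → ℝ) := (fun x : Fin (n + 1) → ℝ => j.removeNth x) '' S
  have hlip : LipschitzWith 1 (fun x : Fin (n + 1) → ℝ => j.removeNth x) := by
    refine LipschitzWith.of_dist_le_mul fun x y => ?_
    rw [NNReal.coe_one, one_mul, dist_pi_le_iff dist_nonneg]
    exact fun i => dist_le_pi_dist x y _
  have hA : IsCompact A := hS.image hlip.continuous
  have hmp := measurePreserving_piFinSuccAbove (fun _ : Fin (n + 1) => unitMeasure) j
  have hsub : axisShadow j S ⊆
      MeasurableEquiv.piFinSuccAbove (fun _ => ℝ) j ⁻¹' (univ ×ˢ A) := by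
    rintro x ⟨-, t, -, ht⟩
    refine ⟨mem_univ _, _, ht, ?_⟩
    ext i
    simp only [Fin.removeNth, ne_eq, Fin.succAbove_ne, not_false_eq_true, Function.update_of_ne]
    rfl
  calc _ ≤ _ := measure_mono hsub
    _ = _ := hmp.measure_preimage (MeasurableSet.univ.prod hA.measurableSet).nullMeasurableSet
    _ = Measure.pi (fun _ : Fin n => unitMeasure) A := by simp [Measure.prod_prod]
    _ ≤ volume A := by rw [pi_unitMeasure]; exact Measure.restrict_apply_le _ _
    _ = μH[(n : ℝ)] A := by
        rw [← hausdorffMeasure_pi_real]; simp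
    _ ≤ μH[(n : ℝ)] S := by
        simpa using hlip.hausdorffMeasure_image_le (Nat.cast_nonneg n) S

/-- A Loomis–Whitney type bound: a set `G` all of whose points see only points of `D` along the
axes. -/
lemma pi_le_rpow_of_axis {n : ℕ} (hn : 1 ≤ n) {D G : Set (Fin (n + 1) → ℝ)}
    (hD : MeasurableSet D) (hG : MeasurableSet G)
    (h : ∀ x ∈ G, ∀ j, ∀ t ∈ Icc (0 : ℝ) 1, Function.update x j t ∈ D) :
    Measure.pi (fun _ : Fin (n + 1) => unitMeasure) G ≤
      Measure.pi (fun _ : Fin (n + 1) => unitMeasure) D ^ (((n : ℝ) + 1) / n) := by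
  have hn0 : (0 : ℝ) < n := by exact_mod_cast hn
  have hp : Real.HolderConjugate (Fintype.card (Fin (n + 1))) (((n : ℝ) + 1) / n) := by
    rw [Real.holderConjugate_iff]
    simp only [Fintype.card_fin, Nat.cast_add, Nat.cast_one]
    refine ⟨by linarith, ?_⟩
    field_simp
    ring
  have := lintegral_prod_lintegral_pow_le (fun _ : Fin (n + 1) => unitMeasure) hp
    (f := D.indicator 1) (measurable_one.indicator hD)
  rw [lintegral_indicator_one hD] at this
  refine le_trans ?_ this
  rw [← lintegral_indicator_one hG]
  refine lintegral_mono fun x => ?_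
  by_cases hx : x ∈ G
  · rw [indicator_of_mem hx, Pi.one_apply]
    refine le_of_eq (Eq.symm (Finset.prod_eq_one fun j _ => ?_))
    have : ∫⁻ t, D.indicator (1 : (Fin (n + 1) → ℝ) → ℝ≥0∞) (Function.update x j t) ∂unitMeasure = 1 := by
      rw [setLIntegral_congr_fun (g := fun _ => 1) measurableSet_Icc]
      · simp
      · intro t ht
        exact indicator_of_mem (h x hx j t ht) _
    rw [this, ENNReal.one_rpow]
  · rw [indicator_of_notMem hx]; exact zero_le

/-- Relative isoperimetric inequality for open partitions in the unit cube. -/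
theorem exists_cell_cube_isoperimetric {n N : ℕ} (hn : 1 ≤ n) (hN : 0 < N)
    {E : Fin N → Set (Fin (n + 1) → ℝ)} (hE : ∀ i, IsOpen (E i))
    (hd : Pairwise fun i j => Disjoint (E i) (E j)) :
    ∃ i, volume (unitCube (Fin (n + 1)) \ E i) ≤
      (2 * (n + 1) * μH[(n : ℝ)] ((⋃ i, E i)ᶜ ∩ unitCube (Fin (n + 1)))) ^
        (((n : ℝ) + 1) / n) := by
  set Q := unitCube (Fin (n + 1)) with hQdef
  set S := (⋃ i, E i)ᶜ ∩ Q with hS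
  have hScl : IsClosed (⋃ i, E i)ᶜ := (isOpen_iUnion hE).isClosed_compl
  have hQc : IsCompact Q := isCompact_unitCube _
  have hSc : IsCompact S := hQc.inter_left hScl
  have hSm : ∀ j, MeasurableSet (axisShadow j S) := fun j =>
    (isClosed_axisShadow j hSc.isClosed).measurableSet
  have hcell : ∀ j, ∀ x ∈ Q, x ∉ axisShadow j S →
      ∀ i, x ∈ E i → ∀ t ∈ Icc (0 : ℝ) 1, Function.update x j t ∈ E i := by
    intro j x hx hxj i hi t ht
    have hpre : IsPreconnected ((fun t => Function.update x j t) '' Icc (0 : ℝ) 1) :=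
      isPreconnected_Icc.image _ (by fun_prop)
    have hsub : (fun t => Function.update x j t) '' Icc (0 : ℝ) 1 ⊆
        E i ∪ ⋃ k ∈ {k | k ≠ i}, E k := by
      rintro _ ⟨s, hs, rfl⟩
      have : Function.update x j s ∉ S := fun h => hxj ⟨hx, s, hs, h⟩
      have hmem : Function.update x j s ∈ ⋃ i, E i := by
        by_contra hc
        exact this ⟨hc, update_mem_unitCube hx j hs⟩
      obtain ⟨k, hk⟩ := mem_iUnion.1 hmem
      by_cases hki : k = i
      · subst hki; exact Or.inl hk
      · exact Or.inr (mem_biUnion (show k ∈ {k | k ≠ i} from hki) hk)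
    refine hpre.subset_left_of_subset_union (hE i) (isOpen_biUnion fun k _ => hE k) ?_ hsub
      ⟨x, ⟨x j, hx j (mem_univ j), by simp⟩, hi⟩ ⟨t, ht, rfl⟩
    refine disjoint_iUnion₂_right.2 fun k hk => hd (Ne.symm hk)
  obtain ⟨i, hi⟩ := exists_cell_compl_le (Nat.succ_pos n) hN (fun i => (hE i).measurableSet) hd
    (subset_refl _) hSm hcell
  refine ⟨i, ?_⟩
  set μ := Measure.pi (fun _ : Fin (n + 1) => unitMeasure) with hμ
  have hG : MeasurableSet (Q \ E i) := hQc.measurableSet.diff (hE i).measurableSet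
  have hvol : volume (Q \ E i) = μ (Q \ E i) := by
    rw [hμ, pi_unitMeasure, Measure.restrict_apply hG, inter_eq_left.2 sdiff_subset]
  rw [hvol]
  refine (pi_le_rpow_of_axis hn (D := (Q \ E i) ∪ ⋃ j, axisShadow j S)
    (hG.union (MeasurableSet.iUnion hSm)) hG ?_).trans ?_
  · intro x hx j t ht
    have hxt := update_mem_unitCube hx.1 j ht
    by_cases hxj : Function.update x j t ∈ axisShadow j S
    · exact Or.inr (mem_iUnion.2 ⟨j, hxj⟩)
    · refine Or.inl ⟨hxt, fun hmem => hx.2 ?_⟩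
      simpa using hcell j _ hxt hxj i hmem (x j) (hx.1 j (mem_univ j))
  · gcongr
    have hsum : ∑ j, μ (axisShadow j S) ≤ (n + 1) * μH[(n : ℝ)] S := by
      calc ∑ j, μ (axisShadow j S) ≤ ∑ _j : Fin (n + 1), μH[(n : ℝ)] S :=
            Finset.sum_le_sum fun j _ => pi_axisShadow_le j hSc
        _ = _ := by simp
    calc μ ((Q \ E i) ∪ ⋃ j, axisShadow j S)
        ≤ μ (E i)ᶜ + ∑ j, μ (axisShadow j S) :=
          (measure_union_le _ _).trans (add_le_add (measure_mono fun x hx => hx.2)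
            (measure_iUnion_fintype_le _ _))
      _ ≤ (n + 1) * μH[(n : ℝ)] S + (n + 1) * μH[(n : ℝ)] S :=
          add_le_add (hi.trans hsum) hsum
      _ = _ := by ring

/-! ### Slicing by level sets -/

open Filter Topology in
/-- Eilenberg's inequality for a `1`-Lipschitz function. -/
theorem lintegral_hausdorffMeasure_level_le {X : Type*} [EMetricSpace X] [MeasurableSpace X]
    [BorelSpace X] {n : ℕ} (hn : 1 ≤ n) {g : X → ℝ} (hg : LipschitzWith 1 g) (A : Set X) :
    ∫⁻ t, μH[(n : ℝ)] (A ∩ g ⁻¹' {t}) ≤ μH[((n + 1 : ℕ) : ℝ)] A := by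
  by_cases htop : μH[((n + 1 : ℕ) : ℝ)] A = ∞
  · rw [htop]; exact le_top
  have hpos : ∀ k : ℕ, (0 : ℝ≥0∞) < ((k : ℝ≥0∞) + 1)⁻¹ := fun k => by
    simp
  have hcov : ∀ k : ℕ, ∃ U : ℕ → Set X, A ⊆ ⋃ i, U i ∧
      (∀ i, Metric.ediam (U i) ≤ ((k : ℝ≥0∞) + 1)⁻¹) ∧
      ∑' i, Metric.ediam (U i) ^ (n + 1) ≤ μH[((n + 1 : ℕ) : ℝ)] A + ((k : ℝ≥0∞) + 1)⁻¹ := by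
    intro k
    have hle : (⨅ (t : ℕ → Set X) (_ : A ⊆ ⋃ n, t n)
        (_ : ∀ i, Metric.ediam (t i) ≤ ((k : ℝ≥0∞) + 1)⁻¹),
          ∑' i, ⨆ _ : (t i).Nonempty, Metric.ediam (t i) ^ ((n + 1 : ℕ) : ℝ)) <
        μH[((n + 1 : ℕ) : ℝ)] A + ((k : ℝ≥0∞) + 1)⁻¹ := by
      refine lt_of_le_of_lt ?_ (ENNReal.lt_add_right htop (hpos k).ne')
      rw [Measure.hausdorffMeasure_apply ((n + 1 : ℕ) : ℝ) A]
      exact le_iSup₂_of_le _ (hpos k) le_rfl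
    simp only [iInf_lt_iff] at hle
    obtain ⟨U, hU, hdiam, hsum⟩ := hle
    refine ⟨U, hU, hdiam, le_trans (ENNReal.tsum_le_tsum fun i => ?_) hsum.le⟩
    rcases (U i).eq_empty_or_nonempty with h | h
    · simp [h]
    · simp only [h, iSup_pos]
      rw [ENNReal.rpow_natCast]
  choose U hUA hUd hUs using hcov
  let I : ℕ → ℕ → Set ℝ := fun k i => toMeasurable volume (g '' U k i)
  have hI : ∀ k i, volume (I k i) ≤ Metric.ediam (U k i) := fun k i => by
    rw [measure_toMeasurable]
    refine (Real.volume_le_diam _).trans ?_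
    simpa using hg.ediam_image_le (U k i)
  have hlim : Tendsto (fun k : ℕ => ((k : ℝ≥0∞) + 1)⁻¹) atTop (𝓝 0) := by
    have := (tendsto_add_atTop_iff_nat 1).2 ENNReal.tendsto_inv_nat_nhds_zero
    simpa using this
  have hpt : ∀ t, μH[(n : ℝ)] (A ∩ g ⁻¹' {t}) ≤
      liminf (fun k => ∑' i, (I k i).indicator (fun _ => Metric.ediam (U k i) ^ n) t) atTop := by
    intro t
    refine (Measure.hausdorffMeasure_le_liminf_tsum (n : ℝ) (A ∩ g ⁻¹' {t})
      (fun k : ℕ => ((k : ℝ≥0∞) + 1)⁻¹) hlim (fun k i => U k i ∩ g ⁻¹' {t})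
      (Eventually.of_forall fun k i => (Metric.ediam_mono inter_subset_left).trans (hUd k i))
      (Eventually.of_forall fun k => ?_)).trans ?_
    · rw [← iUnion_inter]
      exact inter_subset_inter_left _ (hUA k)
    · refine liminf_le_liminf (Eventually.of_forall fun k => ENNReal.tsum_le_tsum fun i => ?_)
      rcases (U k i ∩ g ⁻¹' {t}).eq_empty_or_nonempty with h | ⟨x, hx⟩
      · have : n ≠ 0 := by omega
        simp [h, this]
      · have ht : t ∈ I k i := subset_toMeasurable _ _ ⟨x, hx.1, hx.2⟩
        rw [indicator_of_mem ht, ENNReal.rpow_natCast]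
        gcongr
        exact inter_subset_left
  calc ∫⁻ t, μH[(n : ℝ)] (A ∩ g ⁻¹' {t})
      ≤ ∫⁻ t, liminf (fun k => ∑' i,
          (I k i).indicator (fun _ => Metric.ediam (U k i) ^ n) t) atTop := lintegral_mono hpt
    _ ≤ liminf (fun k => ∫⁻ t, ∑' i,
          (I k i).indicator (fun _ => Metric.ediam (U k i) ^ n) t) atTop :=
        lintegral_liminf_le fun k => Measurable.tsum fun i =>
          measurable_const.indicator (measurableSet_toMeasurable _ _)
    _ ≤ liminf (fun k : ℕ => μH[((n + 1 : ℕ) : ℝ)] A + ((k : ℝ≥0∞) + 1)⁻¹) atTop := by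
        refine liminf_le_liminf (Eventually.of_forall fun k => ?_)
        refine le_trans (le_of_eq (lintegral_tsum fun i =>
          (measurable_const.indicator (measurableSet_toMeasurable _ _)).aemeasurable)) ?_
        refine le_trans (ENNReal.tsum_le_tsum fun i => ?_) (hUs k)
        rw [lintegral_indicator_const (measurableSet_toMeasurable _ _), pow_succ]
        gcongr
        exact hI k i
    _ = μH[((n + 1 : ℕ) : ℝ)] A := by
        have : Tendsto (fun k : ℕ => μH[((n + 1 : ℕ) : ℝ)] A + ((k : ℝ≥0∞) + 1)⁻¹) atTop
            (𝓝 (μH[((n + 1 : ℕ) : ℝ)] A + 0)) := tendsto_const_nhds.add hlim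
        rw [this.liminf_eq, add_zero]

/-! ### Lebesgue measure and Hausdorff measure -/

lemma volume_eq_hausdorffMeasure_ofLp {m : ℕ} (A : Set (Euc m)) :
    volume A = μH[(m : ℝ)] (WithLp.ofLp '' A : Set (Fin m → ℝ)) := by
  have h := hausdorffMeasure_pi_real (ι := Fin m)
  rw [Fintype.card_fin] at h
  rw [h]
  have := (EuclideanSpace.volume_preserving_symm_measurableEquiv_toLp (Fin m)).measure_preimage_equiv
    (WithLp.ofLp '' A)
  rw [← this]
  congr 1
  exact (preimage_image_eq A (WithLp.ofLp_injective 2)).symm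

lemma volume_le_hausdorffMeasure {m : ℕ} (A : Set (Euc m)) : volume A ≤ μH[(m : ℝ)] A := by
  rw [volume_eq_hausdorffMeasure_ofLp]
  simpa using (PiLp.lipschitzWith_ofLp 2 (fun _ : Fin m => ℝ)).hausdorffMeasure_image_le
    (Nat.cast_nonneg m) A

lemma exists_hausdorffMeasure_le_volume (m : ℕ) :
    ∃ K : ℝ≥0, 0 < K ∧ ∀ A : Set (Euc m), μH[(m : ℝ)] A ≤ K * volume A := by
  let L : ℝ≥0 := (Fintype.card (Fin m) : ℝ≥0) ^ (1 / (2 : ℝ≥0∞)).toReal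
  refine ⟨L ^ m + 1, by positivity, fun A => ?_⟩
  have h := (PiLp.lipschitzWith_toLp 2 (fun _ : Fin m => ℝ)).hausdorffMeasure_image_le
    (Nat.cast_nonneg m) (WithLp.ofLp '' A)
  rw [← volume_eq_hausdorffMeasure_ofLp, image_image] at h
  simp only [WithLp.toLp_ofLp, image_id'] at h
  refine h.trans ?_
  rw [ENNReal.rpow_natCast]
  push_cast
  gcongr
  exact le_self_add

/-! ### Transfer to balls -/

/-- The norm preserving radial map between two isomorphic normed spaces. -/
noncomputable def radial {V W : Type*} [NormedAddCommGroup V] [NormedSpace ℝ V]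
    [NormedAddCommGroup W] [NormedSpace ℝ W] (T : V ≃L[ℝ] W) (x : V) : W :=
  (‖x‖ / ‖T x‖) • T x

section Radial

variable {V W : Type*} [NormedAddCommGroup V] [NormedSpace ℝ V]
    [NormedAddCommGroup W] [NormedSpace ℝ W] (T : V ≃L[ℝ] W)

lemma norm_radial (x : V) : ‖radial T x‖ = ‖x‖ := by
  rcases eq_or_ne x 0 with rfl | hx
  · simp [radial]
  · have : ‖T x‖ ≠ 0 := by simpa using hx
    rw [radial, norm_smul, norm_div, norm_norm, norm_norm, div_mul_cancel₀ _ this]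

lemma radial_symm_radial (x : V) : radial T.symm (radial T x) = x := by
  rcases eq_or_ne x 0 with rfl | hx
  · simp [radial]
  · have h1 : ‖T x‖ ≠ 0 := by simpa using hx
    have h2 : ‖x‖ ≠ 0 := by simpa using hx
    rw [radial, norm_radial, radial, map_smul, T.symm_apply_apply, smul_smul, norm_smul, norm_div,
      norm_norm, norm_norm]
    have : ‖x‖ / (‖x‖ / ‖T x‖ * ‖x‖) * (‖x‖ / ‖T x‖) = 1 := by field_simp
    rw [this, one_smul]

lemma exists_lipschitzWith_radial : ∃ K : ℝ≥0, LipschitzWith K (radial T) := by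
  let a : ℝ≥0 := ‖(T : V →L[ℝ] W)‖₊
  let b : ℝ≥0 := ‖(T.symm : W →L[ℝ] V)‖₊
  refine ⟨2 * (b * a) + 1, LipschitzWith.of_dist_le_mul fun x y => ?_⟩
  have hT : ∀ z, ‖T z‖ ≤ a * ‖z‖ := fun z => (T : V →L[ℝ] W).le_opNorm z
  have hT' : ∀ z, ‖z‖ ≤ b * ‖T z‖ := fun z => by
    have := (T.symm : W →L[ℝ] V).le_opNorm (T z)
    rwa [ContinuousLinearEquiv.coe_coe, T.symm_apply_apply] at this
  have hab : (0 : ℝ) ≤ 2 * (b * a) := by positivity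
  rw [dist_eq_norm, dist_eq_norm]
  push_cast
  rcases eq_or_ne x 0 with rfl | hx
  · simp only [radial, map_zero, smul_zero, zero_sub, norm_neg]
    rw [← radial, norm_radial]
    nlinarith [norm_nonneg y]
  rcases eq_or_ne y 0 with rfl | hy
  · simp only [radial, map_zero, smul_zero, sub_zero]
    rw [← radial, norm_radial]
    nlinarith [norm_nonneg x]
  have hx1 : 0 < ‖T x‖ := by simpa using hx
  have hy1 : 0 < ‖T y‖ := by simpa using hy
  have hsplit : radial T x - radial T y =
      (‖x‖ / ‖T x‖) • T (x - y) + (‖x‖ / ‖T x‖ - ‖y‖ / ‖T y‖) • T y := by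
    simp only [radial, map_sub]; module
  have hq : ‖x‖ / ‖T x‖ ≤ b := by rw [div_le_iff₀ hx1]; exact hT' x
  have h1 : ‖(‖x‖ / ‖T x‖) • T (x - y)‖ ≤ b * a * ‖x - y‖ := by
    rw [norm_smul, norm_div, norm_norm, norm_norm, mul_assoc]
    exact mul_le_mul hq (hT _) (norm_nonneg _) b.2
  have h2 : ‖(‖x‖ / ‖T x‖ - ‖y‖ / ‖T y‖) • T y‖ ≤ b * a * ‖x - y‖ + ‖x - y‖ := by
    rw [norm_smul, Real.norm_eq_abs]
    have : (‖x‖ / ‖T x‖ - ‖y‖ / ‖T y‖) * ‖T y‖ =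
        ‖x‖ / ‖T x‖ * (‖T y‖ - ‖T x‖) + (‖x‖ - ‖y‖) := by field_simp; ring
    rw [← abs_of_pos hy1, ← abs_mul, abs_of_pos hy1, this]
    refine (abs_add_le _ _).trans (add_le_add ?_ (abs_norm_sub_norm_le x y))
    rw [abs_mul, abs_of_nonneg (by positivity : 0 ≤ ‖x‖ / ‖T x‖), mul_assoc]
    refine mul_le_mul hq ?_ (abs_nonneg _) b.2
    rw [abs_sub_comm]
    refine (abs_norm_sub_norm_le _ _).trans ?_
    rw [← map_sub]
    exact hT _
  rw [hsplit]
  refine (norm_add_le _ _).trans ?_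
  linarith

end Radial

lemma mem_unitCube_iff_norm {m : ℕ} (x : Fin m → ℝ) :
    x ∈ unitCube (Fin m) ↔ ‖(2 : ℝ) • x - 1‖ ≤ 1 := by
  rw [pi_norm_le_iff_of_nonneg zero_le_one]
  simp only [unitCube, mem_pi, mem_univ, true_imp_iff, mem_Icc, Pi.sub_apply, Pi.smul_apply,
    Pi.one_apply, smul_eq_mul, Real.norm_eq_abs, abs_le]
  refine forall_congr' fun i => ⟨fun h => ⟨by linarith, by linarith⟩,
    fun h => ⟨by linarith, by linarith⟩⟩

/-- Relative isoperimetric inequality for open partitions in balls. -/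
theorem exists_cell_ball_isoperimetric {n : ℕ} (hn : 1 ≤ n) :
    ∃ C : ℝ≥0, 0 < C ∧ ∀ r : ℝ, 0 < r → ∀ N : ℕ, 0 < N → ∀ E : Fin N → Set (Euc (n + 1)),
      (∀ i, IsOpen (E i)) → (Pairwise fun i j => Disjoint (E i) (E j)) →
      ∃ i, volume (Metric.closedBall 0 r \ E i) ≤
        C * μH[(n : ℝ)] ((⋃ i, E i)ᶜ ∩ Metric.closedBall 0 r) ^ (((n : ℝ) + 1) / n) := by
  let T := EuclideanSpace.equiv (Fin (n + 1)) ℝ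
  obtain ⟨K₁, hK₁⟩ := exists_lipschitzWith_radial T
  obtain ⟨K₂, hK₂⟩ := exists_lipschitzWith_radial T.symm
  have hn0 : (0 : ℝ) < n := by exact_mod_cast hn
  set p : ℝ := ((n : ℝ) + 1) / n with hp
  have hp0 : 0 ≤ p := by positivity
  let C : ℝ≥0 := (2 * K₂) ^ (n + 1) * ((2 * (n + 1) * K₁ ^ n) ^ p)
  refine ⟨C + 1, by positivity, fun r hr N hN E hE hd => ?_⟩
  lift r to ℝ≥0 using hr.le
  have hr' : 0 < r := by exact_mod_cast hr
  let φ : (Fin (n + 1) → ℝ) → Euc (n + 1) := fun x => (r : ℝ) • radial T.symm ((2 : ℝ) • x - 1)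
  let ψ : Euc (n + 1) → Fin (n + 1) → ℝ := fun y =>
    (2⁻¹ : ℝ) • (radial T ((r : ℝ)⁻¹ • y) + 1)
  have hφψ : ∀ y, φ (ψ y) = y := fun y => by
    simp only [φ, ψ, smul_smul]
    rw [mul_inv_cancel₀ two_ne_zero, one_smul, add_sub_cancel_right, radial_symm_radial,
      smul_smul, mul_inv_cancel₀ hr.ne', one_smul]
  have hψφ : ∀ x, ψ (φ x) = x := fun x => by
    simp only [φ, ψ, smul_smul]
    have := radial_symm_radial T.symm ((2 : ℝ) • x - 1)
    rw [T.symm_symm] at this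
    rw [inv_mul_cancel₀ hr.ne', one_smul, this, sub_add_cancel, smul_smul,
      inv_mul_cancel₀ two_ne_zero, one_smul]
  have hφlip : LipschitzWith (r * (K₂ * 2)) φ := by
    have h1 : LipschitzWith 2 (fun x : Fin (n + 1) → ℝ => (2 : ℝ) • x - 1) := by
      refine LipschitzWith.of_dist_le_mul fun x y => ?_
      rw [dist_sub_right, dist_smul₀]; simp
    have h2 : LipschitzWith r (fun x : Euc (n + 1) => (r : ℝ) • x) := by
      refine LipschitzWith.of_dist_le_mul fun x y => ?_
      rw [dist_smul₀]; simp
    exact h2.comp (hK₂.comp h1)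
  have hψlip : LipschitzWith (K₁ * r⁻¹) ψ := by
    have h1 : LipschitzWith 1 (fun x : Fin (n + 1) → ℝ => (2⁻¹ : ℝ) • (x + 1)) := by
      refine LipschitzWith.of_dist_le_mul fun x y => ?_
      rw [dist_smul₀, dist_add_right]
      norm_num
      linarith [dist_nonneg (x := x) (y := y)]
    have h2 : LipschitzWith r⁻¹ (fun x : Euc (n + 1) => (r : ℝ)⁻¹ • x) := by
      refine LipschitzWith.of_dist_le_mul fun x y => ?_
      rw [dist_smul₀]; simp
    have := h1.comp (hK₁.comp h2)
    rwa [one_mul] at this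
  have hball : ∀ x, φ x ∈ Metric.closedBall (0 : Euc (n + 1)) r ↔
      x ∈ unitCube (Fin (n + 1)) := fun x => by
    rw [mem_unitCube_iff_norm, mem_closedBall_zero_iff, norm_smul, norm_radial]
    simp only [NNReal.norm_eq]
    exact mul_le_iff_le_one_right hr
  obtain ⟨i, hi⟩ := exists_cell_cube_isoperimetric hn hN (E := fun i => φ ⁻¹' E i)
    (fun i => (hE i).preimage hφlip.continuous) (fun i j hij => (hd hij).preimage φ)
  refine ⟨i, ?_⟩
  have himg : Metric.closedBall (0 : Euc (n + 1)) r \ E i =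
      φ '' (unitCube (Fin (n + 1)) \ φ ⁻¹' E i) := by
    ext y
    constructor
    · intro hy
      exact ⟨ψ y, ⟨(hball _).1 (by rw [hφψ]; exact hy.1), by
        rw [mem_preimage, hφψ]; exact hy.2⟩, hφψ y⟩
    · rintro ⟨x, hx, rfl⟩
      exact ⟨(hball x).2 hx.1, hx.2⟩
  have hΓ : (⋃ i, φ ⁻¹' E i)ᶜ ∩ unitCube (Fin (n + 1)) =
      ψ '' ((⋃ i, E i)ᶜ ∩ Metric.closedBall 0 r) := by
    ext x
    constructor
    · intro hx
      refine ⟨φ x, ⟨?_, (hball x).2 hx.2⟩, hψφ x⟩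
      have := hx.1
      rwa [← preimage_iUnion] at this
    · rintro ⟨y, hy, rfl⟩
      refine ⟨?_, (hball _).1 (by rw [hφψ]; exact hy.2)⟩
      rw [← preimage_iUnion, mem_compl_iff, mem_preimage, hφψ]
      exact hy.1
  set M := μH[(n : ℝ)] ((⋃ i, E i)ᶜ ∩ Metric.closedBall (0 : Euc (n + 1)) r) with hM
  have hcube : volume (unitCube (Fin (n + 1)) \ φ ⁻¹' E i) =
      μH[((n + 1 : ℕ) : ℝ)] (unitCube (Fin (n + 1)) \ φ ⁻¹' E i) := by
    have h := hausdorffMeasure_pi_real (ι := Fin (n + 1))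
    rw [Fintype.card_fin] at h
    rw [h]
  calc volume (Metric.closedBall 0 (r : ℝ) \ E i)
      ≤ μH[((n + 1 : ℕ) : ℝ)] (Metric.closedBall 0 (r : ℝ) \ E i) := volume_le_hausdorffMeasure _
    _ ≤ ((r * (K₂ * 2) : ℝ≥0) : ℝ≥0∞) ^ (n + 1) *
          volume (unitCube (Fin (n + 1)) \ φ ⁻¹' E i) := by
        rw [himg, hcube, ← ENNReal.rpow_natCast]
        exact hφlip.hausdorffMeasure_image_le (Nat.cast_nonneg _) _
    _ ≤ ((r * (K₂ * 2) : ℝ≥0) : ℝ≥0∞) ^ (n + 1) *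
          (2 * (n + 1) * (((K₁ * r⁻¹ : ℝ≥0) : ℝ≥0∞) ^ n * M)) ^ p := by
        gcongr
        refine hi.trans ?_
        gcongr
        rw [hΓ, ← ENNReal.rpow_natCast]
        exact hψlip.hausdorffMeasure_image_le (Nat.cast_nonneg _) _
    _ = C * M ^ p := by
        have e1 : 2 * ((n : ℝ≥0∞) + 1) * (((K₁ * r⁻¹ : ℝ≥0) : ℝ≥0∞) ^ n * M) =
            ((2 * (n + 1) * K₁ ^ n : ℝ≥0) : ℝ≥0∞) * ((r⁻¹ : ℝ≥0) : ℝ≥0∞) ^ n * M := by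
          push_cast; ring
        have e2 : (((r⁻¹ : ℝ≥0) : ℝ≥0∞) ^ n) ^ p = ((r⁻¹ : ℝ≥0) : ℝ≥0∞) ^ (n + 1) := by
          rw [← ENNReal.rpow_natCast, ← ENNReal.rpow_mul, hp, mul_div_cancel₀ _ hn0.ne',
            ← ENNReal.rpow_natCast]
          push_cast; rfl
        have e3 : (r : ℝ≥0∞) ^ (n + 1) * ((r⁻¹ : ℝ≥0) : ℝ≥0∞) ^ (n + 1) = 1 := by
          rw [← mul_pow, ← ENNReal.coe_mul, mul_inv_cancel₀ hr'.ne']; simp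
        have hC : (C : ℝ≥0∞) = (2 * (K₂ : ℝ≥0∞)) ^ (n + 1) *
            (2 * ((n : ℝ≥0∞) + 1) * (K₁ : ℝ≥0∞) ^ n) ^ p := by
          simp only [C]
          rw [ENNReal.coe_mul, ENNReal.coe_rpow_of_nonneg _ hp0]
          push_cast
          rfl
        rw [e1, ENNReal.mul_rpow_of_nonneg _ _ hp0, ENNReal.mul_rpow_of_nonneg _ _ hp0, e2, hC]
        push_cast
        calc _ = ((r : ℝ≥0∞) ^ (n + 1) * ((r⁻¹ : ℝ≥0) : ℝ≥0∞) ^ (n + 1)) *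
              ((2 * (K₂ : ℝ≥0∞)) ^ (n + 1) *
                (2 * ((n : ℝ≥0∞) + 1) * (K₁ : ℝ≥0∞) ^ n) ^ p * M ^ p) := by ring
          _ = _ := by rw [e3, one_mul]
    _ ≤ ((C + 1 : ℝ≥0) : ℝ≥0∞) * M ^ p := by
        gcongr
        exact le_self_add

/-! ### The expansion map -/

section Expansion

variable {V : Type*} [NormedAddCommGroup V] [NormedSpace ℝ V] {a : V} {r δ : ℝ}

/-- The Minkowski gauge of the closed ball `B_r`, seen from the point `a`. -/
noncomputable def ballGauge (a : V) (r : ℝ) (x : V) : ℝ := gauge (Metric.closedBall (-a) r) (x - a)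

/-- The map that is the identity off `B_r`, expands a `δ`-homothetic copy of `B_r` with centre `a`
onto `B_r`, and projects the rest of `B_r` radially from `a` to the sphere. -/
noncomputable def expansion (a : V) (r δ : ℝ) (x : V) : V :=
  a + (min 1 (max δ (ballGauge a r x)))⁻¹ • (x - a)

lemma closedBall_neg_mem_nhds {V : Type*} [NormedAddCommGroup V] {a : V} {r : ℝ} (ha : ‖a‖ < r) :
    Metric.closedBall (-a) r ∈ nhds (0 : V) :=
  Metric.closedBall_mem_nhds_of_mem (by simpa using ha)

lemma ballGauge_le_one_iff (ha : ‖a‖ < r) {x : V} : ballGauge a r x ≤ 1 ↔ ‖x‖ ≤ r := by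
  rw [ballGauge, gauge_le_one_iff_mem_closure (convex_closedBall _ _) (closedBall_neg_mem_nhds ha),
    Metric.isClosed_closedBall.closure_eq, mem_closedBall_iff_norm]
  simp

lemma ballGauge_lt_one_iff (ha : ‖a‖ < r) {x : V} : ballGauge a r x < 1 ↔ ‖x‖ < r := by
  have hr : r ≠ 0 := ((norm_nonneg a).trans_lt ha).ne'
  rw [ballGauge, gauge_lt_one_iff_mem_interior (convex_closedBall _ _)
    (closedBall_neg_mem_nhds ha), interior_closedBall _ hr, mem_ball_iff_norm]
  simp

lemma ballGauge_eq_one_iff (ha : ‖a‖ < r) {x : V} : ballGauge a r x = 1 ↔ ‖x‖ = r := by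
  rw [eq_iff_le_not_lt, ballGauge_le_one_iff ha, ballGauge_lt_one_iff ha, ← eq_iff_le_not_lt]

lemma ballGauge_homothety {t : ℝ} (ht : 0 ≤ t) (x : V) :
    ballGauge a r (a + t • (x - a)) = t * ballGauge a r x := by
  rw [ballGauge, add_sub_cancel_left, gauge_smul_of_nonneg ht, smul_eq_mul, ballGauge]

lemma expansion_of_le_norm (ha : ‖a‖ < r) {x : V} (hx : r ≤ ‖x‖) : expansion a r δ x = x := by
  have h : 1 ≤ ballGauge a r x := by
    rw [← not_lt, ballGauge_lt_one_iff ha]; exact not_lt.2 hx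
  rw [expansion, min_eq_left (h.trans (le_max_right _ _)), inv_one, one_smul, add_sub_cancel]

lemma expansion_homothety_of_norm_le (hδ : 0 < δ) (hδ1 : δ ≤ 1) (ha : ‖a‖ < r) {y : V}
    (hy : ‖y‖ ≤ r) : expansion a r δ (a + δ • (y - a)) = y := by
  have h := (ballGauge_le_one_iff ha).2 hy
  rw [expansion, ballGauge_homothety hδ.le, max_eq_left (by nlinarith), min_eq_right hδ1,
    add_sub_cancel_left, smul_smul, inv_mul_cancel₀ hδ.ne', one_smul, add_sub_cancel]

lemma expansion_homothety_of_norm_eq (hδ : 0 < δ) (ha : ‖a‖ < r) {y : V} (hy : ‖y‖ = r) {t : ℝ}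
    (ht : t ∈ Icc δ 1) : expansion a r δ (a + t • (y - a)) = y := by
  have ht0 : 0 < t := hδ.trans_le ht.1
  rw [expansion, ballGauge_homothety ht0.le, (ballGauge_eq_one_iff ha).2 hy, mul_one,
    max_eq_right ht.1, min_eq_right ht.2, add_sub_cancel_left, smul_smul, inv_mul_cancel₀ ht0.ne',
    one_smul, add_sub_cancel]

lemma norm_expansion_of_le_ballGauge (hδ : 0 < δ) (ha : ‖a‖ < r) {x : V} (hx : ‖x‖ ≤ r)
    (hg : δ ≤ ballGauge a r x) : ‖expansion a r δ x‖ = r := by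
  have h0 : 0 < ballGauge a r x := hδ.trans_le hg
  rw [← ballGauge_eq_one_iff ha, expansion, max_eq_right hg,
    min_eq_right ((ballGauge_le_one_iff ha).2 hx), ballGauge_homothety (inv_nonneg.2 h0.le),
    inv_mul_cancel₀ h0.ne']

/-- A point of `B_r` either goes to the sphere, or is in the small homothetic copy of `B_r`. -/
lemma norm_expansion_eq_or (hδ : 0 < δ) (ha : ‖a‖ < r) {x : V} (hx : ‖x‖ ≤ r) :
    ‖expansion a r δ x‖ = r ∨ ∃ y, ‖y‖ ≤ r ∧ x = a + δ • (y - a) := by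
  rcases le_or_gt δ (ballGauge a r x) with hg | hg
  · exact Or.inl (norm_expansion_of_le_ballGauge hδ ha hx hg)
  · refine Or.inr ⟨a + δ⁻¹ • (x - a), ?_, ?_⟩
    · rw [← ballGauge_le_one_iff ha, ballGauge_homothety (inv_nonneg.2 hδ.le)]
      rw [inv_mul_le_iff₀ hδ]; linarith
    · rw [add_sub_cancel_left, smul_smul, mul_inv_cancel₀ hδ.ne', one_smul, add_sub_cancel]

lemma norm_expansion_le (hδ : 0 < δ) (hδ1 : δ ≤ 1) (ha : ‖a‖ < r) {x : V} (hx : ‖x‖ ≤ r) :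
    ‖expansion a r δ x‖ ≤ r := by
  rcases norm_expansion_eq_or hδ ha hx with h | ⟨y, hy, rfl⟩
  · exact h.le
  · rwa [expansion_homothety_of_norm_le hδ hδ1 ha hy]

lemma norm_expansion_sub_le (hδ : 0 < δ) (hδ1 : δ ≤ 1) (ha : ‖a‖ < r) (x : V) :
    ‖expansion a r δ x - x‖ ≤ 2 * r := by
  rcases le_total r ‖x‖ with h | h
  · rw [expansion_of_le_norm ha h, sub_self, norm_zero]
    linarith [norm_nonneg a]
  · linarith [norm_sub_le (expansion a r δ x) x, norm_expansion_le hδ hδ1 ha h]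

lemma exists_lipschitzWith_expansion (hδ : 0 < δ) (hδ1 : δ ≤ 1) (ha : ‖a‖ < r) :
    ∃ K : ℝ≥0, LipschitzWith K (expansion a r δ) := by
  obtain ⟨L, hL⟩ := (convex_closedBall (-a) r).lipschitz_gauge (closedBall_neg_mem_nhds ha)
  have hr : 0 < r := (norm_nonneg a).trans_lt ha
  set m : V → ℝ := fun x => min 1 (max δ (ballGauge a r x)) with hm
  have hg : LipschitzWith L (ballGauge a r) := by
    refine LipschitzWith.of_dist_le_mul fun x y => ?_
    have := hL.dist_le_mul (x - a) (y - a)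
    rwa [dist_sub_right] at this
  have hmL : LipschitzWith L m := (hg.const_max δ).const_min 1
  have hmδ : ∀ x, δ ≤ m x := fun x => le_min hδ1 (le_max_left _ _)
  have hm0 : ∀ x, 0 < m x := fun x => hδ.trans_le (hmδ x)
  let K : ℝ≥0 := ⟨δ⁻¹ + L / δ ^ 2 * (2 * r) + 1, by positivity⟩
  have key : ∀ x y : V, ‖y‖ ≤ r → dist (expansion a r δ x) (expansion a r δ y) ≤ K * dist x y := by
    intro x y hy
    have hd : 0 ≤ dist x y := dist_nonneg
    have hsplit : expansion a r δ x - expansion a r δ y =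
        (m x)⁻¹ • (x - y) + ((m x)⁻¹ - (m y)⁻¹) • (y - a) := by
      simp only [expansion]; module
    have h1 : ‖(m x)⁻¹ • (x - y)‖ ≤ δ⁻¹ * dist x y := by
      rw [norm_smul, dist_eq_norm, Real.norm_of_nonneg (inv_nonneg.2 (hm0 x).le)]
      gcongr
      exact hmδ x
    have h2 : |(m x)⁻¹ - (m y)⁻¹| ≤ L / δ ^ 2 * dist x y := by
      rw [inv_sub_inv (hm0 x).ne' (hm0 y).ne', abs_div, abs_of_pos (mul_pos (hm0 x) (hm0 y)),
        abs_sub_comm, ← Real.dist_eq]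
      calc dist (m x) (m y) / (m x * m y) ≤ (L * dist x y) / (δ * δ) := by
            gcongr
            · exact hmL.dist_le_mul x y
            · exact hmδ x
            · exact hmδ y
        _ = L / δ ^ 2 * dist x y := by ring
    have h3 : ‖((m x)⁻¹ - (m y)⁻¹) • (y - a)‖ ≤ L / δ ^ 2 * dist x y * (2 * r) := by
      rw [norm_smul, Real.norm_eq_abs]
      refine mul_le_mul h2 ?_ (norm_nonneg _) (by positivity)
      linarith [norm_sub_le y a]
    rw [dist_eq_norm, hsplit]
    refine (norm_add_le _ _).trans ((add_le_add h1 h3).trans ?_)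
    have : (K : ℝ) = δ⁻¹ + L / δ ^ 2 * (2 * r) + 1 := rfl
    rw [this]
    nlinarith
  refine ⟨K, LipschitzWith.of_dist_le_mul fun x y => ?_⟩
  rcases le_total ‖y‖ r with hy | hy
  · exact key x y hy
  rcases le_total ‖x‖ r with hx | hx
  · rw [dist_comm, dist_comm x]; exact key y x hx
  · rw [expansion_of_le_norm ha hx, expansion_of_le_norm ha hy]
    have : (1 : ℝ) ≤ K := by
      have : (K : ℝ) = δ⁻¹ + L / δ ^ 2 * (2 * r) + 1 := rfl
      rw [this]
      have : 0 ≤ δ⁻¹ + L / δ ^ 2 * (2 * r) := by positivity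
      linarith
    nlinarith [dist_nonneg (x := x) (y := y)]

end Expansion

lemma inter_frontier_nonempty {X : Type*} [TopologicalSpace X] {s u : Set X}
    (hs : IsPreconnected s) (hu : IsOpen u) (h1 : (s ∩ u).Nonempty) (h2 : (s ∩ uᶜ).Nonempty) :
    (s ∩ frontier u).Nonempty := by
  by_contra h
  have hcl : ∀ y ∈ s, y ∉ u → y ∉ closure u := fun y hy hyu hyc =>
    h ⟨y, hy, hyc, by rwa [hu.interior_eq]⟩
  obtain ⟨y, hy, hyu⟩ := h2
  obtain ⟨z, -, hz, hz'⟩ := hs u (closure u)ᶜ hu isClosed_closure.isOpen_compl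
    (fun z hz => (em (z ∈ u)).imp id (hcl z hz)) h1 ⟨y, hy, hcl y hy hyu⟩
  exact hz' (subset_closure hz)

/-- Expanding a small ball in the cell `E i₀` onto `B_r` removes all the boundaries inside `U_r`. -/
theorem exists_admissible_expansion {m N : ℕ} {E : Fin N → Set (Euc m)} (hE : ∀ i, IsOpen (E i))
    (hd : ∀ i j, i ≠ j → Disjoint (E i) (E j)) (hb : (⋃ i, E i)ᶜ ⊆ bdry E) {r : ℝ} {i₀ : Fin N}
    {a : Euc m} (haE : a ∈ E i₀) (ha : ‖a‖ < r) :
    ∃ f : Euc m → Euc m, IsAdmissible E f ∧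
      (∀ x, x ∉ Metric.ball (0 : Euc m) r → f x = x) ∧
      (∀ x ∈ Metric.closedBall (0 : Euc m) r, f x ∈ Metric.closedBall 0 r) ∧
      bdry (push f E) ∩ Metric.closedBall 0 r ⊆ Metric.sphere 0 r \ E i₀ ∧
      ∀ i, symmDiff (E i) (push f E i) ⊆ Metric.closedBall 0 r \ E i₀ := by
  have hr : 0 < r := (norm_nonneg a).trans_lt ha
  obtain ⟨ρ, hρ, hρE⟩ := Metric.isOpen_iff.1 (hE i₀) a haE
  obtain ⟨δ, hδ, hδ1, hδρ⟩ : ∃ δ : ℝ, 0 < δ ∧ δ ≤ 1 ∧ δ * (2 * r) < ρ := by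
    refine ⟨min 1 (ρ / (4 * r)), lt_min one_pos (by positivity), min_le_left _ _, ?_⟩
    calc min 1 (ρ / (4 * r)) * (2 * r) ≤ ρ / (4 * r) * (2 * r) := by
          gcongr; exact min_le_right _ _
      _ = ρ / 2 := by field_simp; norm_num
      _ < ρ := by linarith
  have hsmall : ∀ y : Euc m, ‖y‖ ≤ r → a + δ • (y - a) ∈ E i₀ := by
    intro y hy
    refine hρE ?_
    rw [mem_ball_iff_norm, add_sub_cancel_left, norm_smul, Real.norm_of_nonneg hδ.le]
    refine lt_of_le_of_lt ?_ hδρ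
    gcongr
    linarith [norm_sub_le y a]
  set f := expansion a r δ with hf
  have hid : ∀ x, r ≤ ‖x‖ → f x = x := fun x hx => expansion_of_le_norm ha hx
  have hout : ∀ i x, x ∈ f '' E i → r < ‖x‖ → x ∈ E i := by
    rintro i _ ⟨y, hy, rfl⟩ hlt
    rcases le_total r ‖y‖ with h | h
    · rwa [hid y h]
    · exact absurd (norm_expansion_le hδ hδ1 ha h) (not_le.2 hlt)
  have himg : ∀ i, i ≠ i₀ → ∀ x ∈ f '' E i, r ≤ ‖x‖ := by
    rintro i hi _ ⟨y, hy, rfl⟩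
    rcases le_total r ‖y‖ with h | h
    · rwa [hid y h]
    · rcases norm_expansion_eq_or hδ ha h with h' | ⟨z, hz, rfl⟩
      · exact h'.ge
      · exact absurd hy (fun hy => (hd i i₀ hi).le_bot ⟨hy, hsmall z hz⟩)
  have hpush : ∀ i, i ≠ i₀ → ∀ x ∈ push f E i, r < ‖x‖ := by
    intro i hi x hx
    have hsub : push f E i ⊆ (Metric.ball (0 : Euc m) r)ᶜ := fun y hy => by
      simpa using himg i hi y (interior_subset hy)
    have : x ∈ interior (Metric.ball (0 : Euc m) r)ᶜ :=
      interior_maximal hsub isOpen_interior hx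
    rw [interior_compl, closure_ball _ hr.ne'] at this
    simpa using this
  have hin : ∀ x, ‖x‖ < r → x ∈ f '' E i₀ := fun x hx =>
    ⟨_, hsmall x hx.le, expansion_homothety_of_norm_le hδ hδ1 ha hx.le⟩
  have hpush₀ : Metric.ball (0 : Euc m) r ∪ E i₀ ⊆ push f E i₀ := by
    refine interior_maximal ?_ (Metric.isOpen_ball.union (hE i₀))
    rintro x hx
    rcases lt_or_ge ‖x‖ r with h | h
    · exact hin x h
    · rcases hx with hx | hx
      · exact absurd (mem_ball_zero_iff.1 hx) (not_lt.2 h)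
      · exact ⟨x, hx, hid x h⟩
  have hpush_out : ∀ i x, x ∈ E i → r < ‖x‖ → x ∈ push f E i := by
    intro i x hx hlt
    have hopen : IsOpen (E i ∩ (Metric.closedBall (0 : Euc m) r)ᶜ) :=
      (hE i).inter Metric.isClosed_closedBall.isOpen_compl
    refine interior_maximal ?_ hopen ⟨hx, by simpa using hlt⟩
    rintro y ⟨hy, hy'⟩
    exact ⟨y, hy, hid y (le_of_lt (by simpa using hy'))⟩
  have hdisj : ∀ i j, i ≠ j → Disjoint (push f E i) (push f E j) := by
    intro i j hij
    rw [Set.disjoint_left]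
    intro x hxi hxj
    have hlt : r < ‖x‖ := by
      by_cases hi : i = i₀
      · exact hpush j (fun h => hij (hi.trans h.symm)) x hxj
      · exact hpush i hi x hxi
    exact (hd i j hij).le_bot ⟨hout i x (interior_subset hxi) hlt,
      hout j x (interior_subset hxj) hlt⟩
  refine ⟨f, ⟨exists_lipschitzWith_expansion hδ hδ1 ha, hdisj, ?_, 2 * r,
    norm_expansion_sub_le hδ hδ1 ha⟩, fun x hx => hid x (by simpa using hx), fun x hx => ?_, ?_, ?_⟩
  · intro x hx
    rw [mem_compl_iff, mem_iUnion, not_exists] at hx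
    have hx0 : x ∉ Metric.ball (0 : Euc m) r ∪ E i₀ := fun h => hx i₀ (hpush₀ h)
    have hxr : r ≤ ‖x‖ := by
      by_contra h
      exact hx0 (Or.inl (by simpa using h))
    rcases hxr.lt_or_eq with hlt | heq
    · refine ⟨x, hb ?_, hid x hxr⟩
      rw [mem_compl_iff, mem_iUnion, not_exists]
      exact fun i hi => hx i (hpush_out i x hi hlt)
    · have hpre : IsPreconnected ((fun t : ℝ => a + t • (x - a)) '' Icc δ 1) :=
        isPreconnected_Icc.image _ (by fun_prop)
      have h1 : ((fun t : ℝ => a + t • (x - a)) '' Icc δ 1 ∩ E i₀).Nonempty :=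
        ⟨_, ⟨δ, ⟨le_rfl, hδ1⟩, rfl⟩, hsmall x heq.ge⟩
      have h2 : ((fun t : ℝ => a + t • (x - a)) '' Icc δ 1 ∩ (E i₀)ᶜ).Nonempty :=
        ⟨x, ⟨1, ⟨hδ1, le_rfl⟩, by simp⟩, fun h => hx0 (Or.inr h)⟩
      obtain ⟨_, ⟨t, ht, rfl⟩, hfr⟩ := inter_frontier_nonempty hpre (hE i₀) h1 h2
      exact ⟨_, mem_iUnion.2 ⟨i₀, hfr⟩, expansion_homothety_of_norm_eq hδ ha heq.symm ht⟩
  · rw [mem_closedBall_zero_iff] at hx ⊢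
    exact norm_expansion_le hδ hδ1 ha hx
  · rintro x ⟨hx, hxr⟩
    obtain ⟨i, hi⟩ := mem_iUnion.1 hx
    have hx0 : x ∉ push f E i₀ := by
      intro h
      by_cases hii : i = i₀
      · subst hii
        rw [frontier, (show IsOpen (push f E i) from isOpen_interior).interior_eq] at hi
        exact hi.2 h
      · have := (hdisj i i₀ hii).closure_left isOpen_interior
        exact this.le_bot ⟨frontier_subset_closure hi, h⟩
    refine ⟨?_, fun h => hx0 (hpush₀ (Or.inr h))⟩
    rw [mem_sphere_zero_iff_norm]
    rw [mem_closedBall_zero_iff] at hxr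
    refine le_antisymm hxr ?_
    by_contra h
    exact hx0 (hpush₀ (Or.inl (by simpa using h)))
  · intro i x hx
    by_cases hii : i = i₀
    · subst hii
      rcases hx with ⟨h1, h2⟩ | ⟨h1, h2⟩
      · exact absurd (hpush₀ (Or.inr h1)) h2
      · refine ⟨?_, h2⟩
        by_contra h
        exact h2 (hout i x (interior_subset h1) (by simpa using h))
    · rcases hx with ⟨h1, h2⟩ | ⟨h1, h2⟩
      · refine ⟨?_, fun h => (hd i i₀ hii).le_bot ⟨h1, h⟩⟩
        by_contra h
        exact h2 (hpush_out i x h1 (by simpa using h))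
      · exact absurd (hout i x (interior_subset h1) (hpush i hii x h1)) h2

/-! ### Boundaries of partitions and the Hausdorff measure -/

/-- The normalizing factor of the Hausdorff measure. -/
noncomputable def hausdorffFactor (n : ℕ) : ℝ≥0∞ := volume (Metric.ball (0 : Euc n) 1) / 2 ^ n

lemma hausdorffFactor_ne_zero (n : ℕ) : hausdorffFactor n ≠ 0 :=
  (ENNReal.div_pos (Metric.measure_ball_pos _ _ one_pos).ne' (by simp)).ne'

lemma hausdorffFactor_ne_top (n : ℕ) : hausdorffFactor n ≠ ∞ :=
  ENNReal.div_ne_top measure_ball_lt_top.ne (by simp)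

lemma hausdorff_apply {n m : ℕ} (A : Set (Euc m)) :
    hausdorff n m A = hausdorffFactor n * μH[(n : ℝ)] A := by
  rw [hausdorff, Measure.smul_apply, smul_eq_mul, hausdorffFactor]

lemma volume_eq_zero_of_hausdorff_ne_top {n : ℕ} {A : Set (Euc (n + 1))}
    (hA : hausdorff n (n + 1) A ≠ ∞) : volume A = 0 := by
  have h : μH[(n : ℝ)] A ≠ ∞ := fun h => hA (by
    rw [hausdorff_apply, h, ENNReal.mul_top (hausdorffFactor_ne_zero n)])
  have h0 := (Measure.hausdorffMeasure_zero_or_top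
    (show (n : ℝ) < ((n + 1 : ℕ) : ℝ) by push_cast; linarith) A).resolve_right h
  exact le_antisymm ((volume_le_hausdorffMeasure A).trans h0.le) zero_le

lemma bdry_eq_compl {n N : ℕ} {Ω : Euc (n + 1) → ℝ} (hΩ : IsWeight Ω)
    {E : Fin N → Set (Euc (n + 1))} (hE : IsOpenPartition Ω E) : bdry E = (⋃ i, E i)ᶜ := by
  refine Subset.antisymm ?_ ?_
  · rintro x hx hx'
    obtain ⟨i, hi⟩ := mem_iUnion.1 hx
    obtain ⟨j, hj⟩ := mem_iUnion.1 hx'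
    by_cases hij : i = j
    · subst hij
      rw [frontier, (hE.isOpen i).interior_eq] at hi
      exact hi.2 hj
    · exact ((hE.disjoint i j hij).closure_left (hE.isOpen j)).le_bot
        ⟨frontier_subset_closure hi, hj⟩
  · intro x hx
    by_contra hxb
    have hxU : x ∈ (⋃ i, closure (E i))ᶜ := by
      intro h
      obtain ⟨i, hi⟩ := mem_iUnion.1 h
      refine hxb (mem_iUnion.2 ⟨i, hi, fun hint => hx (mem_iUnion.2 ⟨i, interior_subset hint⟩)⟩)
    have hU : (⋃ i, closure (E i))ᶜ ∈ nhds x :=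
      (isClosed_iUnion_of_finite fun i => isClosed_closure).isOpen_compl.mem_nhds hxU
    have hΩx : 0 < Ω x := (hΩ.2.1 x).1
    have hΩn : {y | Ω x / 2 < Ω y} ∈ nhds x :=
      (isOpen_lt continuous_const hΩ.1.continuous).mem_nhds (by simpa using hΩx)
    obtain ⟨ε, hε, hsub⟩ := Metric.mem_nhds_iff.1 (Filter.inter_mem hU hΩn)
    have hfin : ENNReal.ofReal (Ω x / 2) * hausdorff n (n + 1) (Metric.ball x ε) < ∞ := by
      refine lt_of_le_of_lt ?_ hE.finite
      have hball : Metric.ball x ε ⊆ (⋃ i, E i)ᶜ := fun y hy h => by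
        obtain ⟨i, hi⟩ := mem_iUnion.1 h
        exact (hsub hy).1 (mem_iUnion.2 ⟨i, subset_closure hi⟩)
      refine le_trans ?_ (measure_mono hball)
      calc ENNReal.ofReal (Ω x / 2) * hausdorff n (n + 1) (Metric.ball x ε)
          = ∫⁻ _ in Metric.ball x ε, ENNReal.ofReal (Ω x / 2) ∂(hausdorff n (n + 1)) := by
            rw [setLIntegral_const]
        _ ≤ ∫⁻ y in Metric.ball x ε, ENNReal.ofReal (Ω y) ∂(hausdorff n (n + 1)) :=
            setLIntegral_mono' measurableSet_ball fun y hy =>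
              ENNReal.ofReal_le_ofReal (hsub hy).2.le
        _ = _ := (withDensity_apply _ measurableSet_ball).symm
    have hne : hausdorff n (n + 1) (Metric.ball x ε) ≠ ∞ := fun h => by
      rw [h, ENNReal.mul_top (by simpa using hΩx)] at hfin
      exact hfin.ne rfl
    exact (Metric.measure_ball_pos volume x hε).ne' (volume_eq_zero_of_hausdorff_ne_top hne)

/-! ### Choice of the radius -/

/-- Lebesgue measure of a shell is bounded below by the areas of the spherical slices. -/
lemma exists_slice_le_volume_shell {n : ℕ} (hn : 1 ≤ n) :
    ∃ D : ℝ, 0 < D ∧ ∀ (F : Set (Euc (n + 1))) (s t : ℝ) (b : ℝ≥0∞),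
      (∀ u ∈ Ioc s t, b ≤ hausdorff n (n + 1) (Metric.sphere 0 u \ F)) →
      ENNReal.ofReal (t - s) * b ≤
        ENNReal.ofReal D * volume ((Metric.closedBall 0 t \ Metric.closedBall 0 s) \ F) := by
  obtain ⟨K, hK0, hK⟩ := exists_hausdorffMeasure_le_volume (n + 1)
  have hκ0 := hausdorffFactor_ne_zero n
  have hκt := hausdorffFactor_ne_top n
  refine ⟨(hausdorffFactor n).toReal * K, mul_pos (ENNReal.toReal_pos hκ0 hκt) hK0,
    fun F s t b hb => ?_⟩
  set A := (Metric.closedBall (0 : Euc (n + 1)) t \ Metric.closedBall 0 s) \ F with hA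
  have hslice : ∀ u ∈ Ioc s t, b ≤ hausdorffFactor n * μH[(n : ℝ)] (A ∩ norm ⁻¹' {u}) := by
    intro u hu
    refine (hb u hu).trans ?_
    rw [← hausdorff_apply]
    refine measure_mono fun x hx => ?_
    have hxu : ‖x‖ = u := by simpa using hx.1
    exact ⟨⟨⟨by simpa [hxu] using hu.2, by simpa [hxu] using hu.1⟩, hx.2⟩, hxu⟩
  calc ENNReal.ofReal (t - s) * b = ∫⁻ _ in Ioc s t, b := by
        rw [setLIntegral_const, Real.volume_Ioc, mul_comm]
    _ ≤ ∫⁻ u in Ioc s t, hausdorffFactor n * μH[(n : ℝ)] (A ∩ norm ⁻¹' {u}) :=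
        setLIntegral_mono' measurableSet_Ioc hslice
    _ ≤ ∫⁻ u, hausdorffFactor n * μH[(n : ℝ)] (A ∩ norm ⁻¹' {u}) := setLIntegral_le_lintegral _ _
    _ = hausdorffFactor n * ∫⁻ u, μH[(n : ℝ)] (A ∩ norm ⁻¹' {u}) := lintegral_const_mul' _ _ hκt
    _ ≤ hausdorffFactor n * (K * volume A) := by
        gcongr
        exact (lintegral_hausdorffMeasure_level_le hn lipschitzWith_one_norm A).trans (hK A)
    _ = _ := by
        rw [ENNReal.ofReal_mul ENNReal.toReal_nonneg, ENNReal.ofReal_toReal hκt,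
          ENNReal.ofReal_coe_nnreal, mul_assoc]

/-- A monotone function that grows at least like a power, and is small at `R`, vanishes at
`3R/4`. -/
lemma nonpos_of_growth {n : ℕ} {v : ℝ → ℝ} {c R : ℝ} (hc : 0 < c) (hR : 0 < R)
    (hmono : ∀ s t, R / 2 ≤ s → s ≤ t → t ≤ R → v s ≤ v t)
    (hv : ∀ s t, R / 2 ≤ s → s ≤ t → t ≤ R → ∀ b, 0 ≤ b → b ^ (n + 1) < v s →
      v s + c * (t - s) * b ^ n ≤ v t)
    (hVR : v R ≤ (c / 2 ^ (n + 4)) ^ (n + 1) * R ^ (n + 1)) : v (3 * R / 4) ≤ 0 := by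
  set a : ℝ := c / 2 ^ (n + 4) * R with ha
  have ha0 : 0 < a := by positivity
  have hrk : ∀ k : ℕ, 0 < (1 / 2 : ℝ) ^ k ∧ (1 / 2 : ℝ) ^ k ≤ 1 := fun k =>
    ⟨by positivity, pow_le_one₀ (by norm_num) (by norm_num)⟩
  have key : ∀ k : ℕ, v (R - R / 4 * (1 - (1 / 2) ^ k)) ≤ ((1 / 2) ^ k * a) ^ (n + 1) := by
    intro k
    induction k with
    | zero => simpa [ha, mul_pow] using hVR
    | succ k ih =>
      by_contra! hlt
      obtain ⟨h0, h1⟩ := hrk k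
      set x : ℝ := (1 / 2) ^ k with hx
      have hx' : (1 / 2 : ℝ) ^ (k + 1) = x / 2 := by rw [pow_succ]; ring
      rw [hx'] at hlt
      have hstep := hv (R - R / 4 * (1 - x / 2)) (R - R / 4 * (1 - x)) (by nlinarith)
        (by nlinarith) (by nlinarith) (x / 2 * a) (by positivity) hlt
      have e : c * (R - R / 4 * (1 - x) - (R - R / 4 * (1 - x / 2))) * (x / 2 * a) ^ n =
          2 * (x * a) ^ (n + 1) := by
        have hcR : c * R = a * 2 ^ (n + 4) := by rw [ha]; field_simp
        have : c * (R - R / 4 * (1 - x) - (R - R / 4 * (1 - x / 2))) = c * R * (x / 8) := by ring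
        rw [this, hcR, show x / 2 * a = x * a / 2 by ring, div_pow, pow_add 2 n 4]
        field_simp
        ring
      rw [e] at hstep
      have hp1 : 0 < (x * a) ^ (n + 1) := by positivity
      have hp2 : 0 < (x / 2 * a) ^ (n + 1) := by positivity
      linarith
  have hlim : Filter.Tendsto (fun k : ℕ => ((1 / 2 : ℝ) ^ k * a) ^ (n + 1)) Filter.atTop
      (nhds ((0 * a) ^ (n + 1))) :=
    ((tendsto_pow_atTop_nhds_zero_of_lt_one (by norm_num) (by norm_num)).mul_const a).pow (n + 1)
  rw [zero_mul, zero_pow (Nat.succ_ne_zero n)] at hlim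
  refine ge_of_tendsto' hlim fun k => ?_
  obtain ⟨h0, h1⟩ := hrk k
  exact (hmono _ _ (by linarith) (by nlinarith) (by nlinarith)).trans (key k)

/-- The relative isoperimetric inequality in terms of the boundary measure. -/
theorem exists_cell_bdryMeasure_isoperimetric {n : ℕ} (hn : 1 ≤ n) :
    ∃ C : ℝ, 0 < C ∧ ∀ (Ω : Euc (n + 1) → ℝ), IsWeight Ω →
      ∀ (N : ℕ), 0 < N → ∀ (E : Fin N → Set (Euc (n + 1))), IsOpenPartition Ω E →
      ∀ r : ℝ, 0 < r → ∃ i, volume (Metric.closedBall 0 r \ E i) ≤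
        ENNReal.ofReal C * bdryMeasure E (Metric.closedBall 0 r) ^ (((n : ℝ) + 1) / n) := by
  obtain ⟨C, hC0, hC⟩ := exists_cell_ball_isoperimetric hn
  have hκ0 := hausdorffFactor_ne_zero n
  have hκt := hausdorffFactor_ne_top n
  have hp : (0 : ℝ) ≤ ((n : ℝ) + 1) / n := by positivity
  refine ⟨C * ((hausdorffFactor n).toReal⁻¹) ^ (((n : ℝ) + 1) / n),
    mul_pos hC0 (Real.rpow_pos_of_pos (inv_pos.2 (ENNReal.toReal_pos hκ0 hκt)) _), ?_⟩
  intro Ω hΩ N hN E hE r hr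
  obtain ⟨i, hi⟩ := hC r hr N hN E hE.isOpen fun i j hij => hE.disjoint i j hij
  refine ⟨i, hi.trans (le_of_eq ?_)⟩
  rw [bdryMeasure, Measure.restrict_apply measurableSet_closedBall, hausdorff_apply,
    bdry_eq_compl hΩ hE, inter_comm, ENNReal.ofReal_mul C.coe_nonneg, ENNReal.ofReal_coe_nnreal,
    ← ENNReal.ofReal_rpow_of_nonneg (inv_nonneg.2 ENNReal.toReal_nonneg) hp,
    ENNReal.ofReal_inv_of_pos (ENNReal.toReal_pos hκ0 hκt), ENNReal.ofReal_toReal hκt, mul_assoc,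
    ← ENNReal.mul_rpow_of_nonneg _ _ hp, ← mul_assoc, ENNReal.inv_mul_cancel hκ0 hκt, one_mul]

/-- Choice of a radius at which the sphere has little area outside of the cell `F`, provided that
`F` satisfies the isoperimetric inequality with respect to `μ` at all radii in `[R/2, R]` and
misses little of `B_R`. -/
theorem exists_radius_slice_le {n : ℕ} (hn : 1 ≤ n) {C : ℝ} (hC : 0 < C) :
    ∃ c : ℝ, 0 < c ∧ ∀ (F : Set (Euc (n + 1))), MeasurableSet F →
      ∀ (μ : Measure (Euc (n + 1))) (R : ℝ), 0 < R → μ (Metric.closedBall 0 R) ≠ ∞ →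
      μ (Metric.closedBall 0 (R / 2)) ≠ 0 →
      (∀ r ∈ Icc (R / 2) R, volume (Metric.closedBall 0 r \ F) ≤
        ENNReal.ofReal C * μ (Metric.closedBall 0 r) ^ (((n : ℝ) + 1) / n)) →
      volume (Metric.closedBall 0 R \ F) ≤ ENNReal.ofReal (c * R ^ (n + 1)) →
      ∃ r ∈ Icc (R / 2) R, hausdorff n (n + 1) (Metric.sphere 0 r \ F) ≤
        (1 / 2 : ℝ≥0∞) * μ (Metric.closedBall 0 r) := by
  obtain ⟨D, hD0, hD⟩ := exists_slice_le_volume_shell hn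
  have hn0 : (0 : ℝ) < n := by exact_mod_cast hn
  set q : ℝ := n / (n + 1) with hq
  have hq0 : 0 ≤ q := by positivity
  have hCq : 0 < C ^ q := Real.rpow_pos_of_pos hC _
  set c : ℝ := 1 / (2 * D * C ^ q) with hc
  have hc0 : 0 < c := by positivity
  refine ⟨(c / 2 ^ (n + 4)) ^ (n + 1), by positivity, ?_⟩
  intro F hF μ R hR hfin hpos hiso hsmall
  by_contra! hcon
  let v : ℝ → ℝ := fun t => (volume (Metric.closedBall (0 : Euc (n + 1)) t \ F)).toReal
  let M : ℝ → ℝ := fun t => (μ (Metric.closedBall (0 : Euc (n + 1)) t)).toReal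
  have hvfin : ∀ t, volume (Metric.closedBall (0 : Euc (n + 1)) t \ F) ≠ ∞ := fun t =>
    ((measure_mono sdiff_subset).trans_lt measure_closedBall_lt_top).ne
  have hMfin : ∀ t ≤ R, μ (Metric.closedBall (0 : Euc (n + 1)) t) ≠ ∞ := fun t ht =>
    ((measure_mono (Metric.closedBall_subset_closedBall ht)).trans_lt hfin.lt_top).ne
  have hgrow : ∀ s t, R / 2 ≤ s → s ≤ t → t ≤ R → v s + (t - s) * M s / (2 * D) ≤ v t := by
    intro s t hs hst ht
    have h1 := hD F s t ((1 / 2 : ℝ≥0∞) * μ (Metric.closedBall 0 s)) fun u hu =>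
      le_trans (by gcongr; exact hu.1.le) (hcon u ⟨hs.trans hu.1.le, hu.2.trans ht⟩).le
    have hshell : volume (Metric.closedBall (0 : Euc (n + 1)) t \ F) =
        volume (Metric.closedBall (0 : Euc (n + 1)) s \ F) +
          volume ((Metric.closedBall (0 : Euc (n + 1)) t \ Metric.closedBall 0 s) \ F) := by
      rw [← measure_union]
      · congr 1
        ext x
        have := Metric.closedBall_subset_closedBall (x := (0 : Euc (n + 1))) hst
        simp only [mem_sdiff, mem_union]
        constructor
        · rintro ⟨h1, h2⟩
          by_cases h : x ∈ Metric.closedBall (0 : Euc (n + 1)) s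
          · exact Or.inl ⟨h, h2⟩
          · exact Or.inr ⟨⟨h1, h⟩, h2⟩
        · rintro (⟨h1, h2⟩ | ⟨⟨h1, _⟩, h2⟩)
          · exact ⟨this h1, h2⟩
          · exact ⟨h1, h2⟩
      · rw [Set.disjoint_left]
        exact fun x hx hx' => hx'.1.2 hx.1
      · exact (measurableSet_closedBall.diff measurableSet_closedBall).diff hF
    set A := (Metric.closedBall (0 : Euc (n + 1)) t \ Metric.closedBall 0 s) \ F with hA
    have hAfin : volume A ≠ ∞ := by
      intro h
      rw [h, add_top] at hshell
      exact hvfin t hshell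
    have h2 := ENNReal.toReal_mono (ENNReal.mul_ne_top ENNReal.ofReal_ne_top hAfin) h1
    rw [ENNReal.toReal_mul, ENNReal.toReal_mul, ENNReal.toReal_mul,
      ENNReal.toReal_ofReal (sub_nonneg.2 hst), ENNReal.toReal_ofReal hD0.le] at h2
    have h3 : v t = v s + (volume A).toReal := by
      simp only [v]
      rw [hshell, ENNReal.toReal_add (hvfin s) hAfin]
    rw [h3, add_le_add_iff_left, div_le_iff₀ (by positivity)]
    have h4 : ((1 / 2 : ℝ≥0∞)).toReal = 1 / 2 := by simp
    rw [h4] at h2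
    simp only [M]
    linarith
  have hv0 := nonpos_of_growth (n := n) (v := v) hc0 hR ?_ ?_ ?_
  · have h := hgrow (R / 2) (3 * R / 4) le_rfl (by linarith) (by linarith)
    have hM : 0 < M (R / 2) := ENNReal.toReal_pos hpos (hMfin _ (by linarith))
    have hv : 0 ≤ v (R / 2) := ENNReal.toReal_nonneg
    have : 0 < (3 * R / 4 - R / 2) * M (R / 2) / (2 * D) :=
      div_pos (mul_pos (by linarith) hM) (by positivity)
    linarith
  · intro s t hs hst ht
    exact ENNReal.toReal_mono (hvfin t)
      (measure_mono (sdiff_subset_sdiff_left (Metric.closedBall_subset_closedBall hst)))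
  · intro s t hs hst ht b hb hbv
    refine le_trans ?_ (hgrow s t hs hst ht)
    have hMs : 0 ≤ M s := ENNReal.toReal_nonneg
    have hi : v s ≤ C * M s ^ (((n : ℝ) + 1) / n) := by
      have := ENNReal.toReal_mono (ENNReal.mul_ne_top ENNReal.ofReal_ne_top
        (ENNReal.rpow_ne_top_of_nonneg (by positivity) (hMfin s (hst.trans ht))))
        (hiso s ⟨hs, hst.trans ht⟩)
      rwa [ENNReal.toReal_mul, ENNReal.toReal_ofReal hC.le, ← ENNReal.toReal_rpow] at this
    have hbn : b ^ n ≤ C ^ q * M s := by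
      have h := Real.rpow_le_rpow (by positivity) (hbv.le.trans hi) hq0
      rw [Real.mul_rpow hC.le (by positivity), ← Real.rpow_mul hMs, hq,
        div_mul_div_cancel₀ (by positivity), div_self (by positivity), Real.rpow_one,
        ← Real.rpow_natCast b (n + 1), ← Real.rpow_mul hb] at h
      have e : ((n + 1 : ℕ) : ℝ) * (n / (n + 1)) = (n : ℕ) := by
        push_cast; field_simp
      rwa [e, Real.rpow_natCast] at h
    rw [add_le_add_iff_left, hc]
    calc 1 / (2 * D * C ^ q) * (t - s) * b ^ n
        ≤ 1 / (2 * D * C ^ q) * (t - s) * (C ^ q * M s) := by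
          have := sub_nonneg.2 hst
          gcongr
      _ = (t - s) * M s / (2 * D) := by field_simp
  · exact ENNReal.toReal_le_of_le_ofReal (by positivity) hsmall

end OpenPartition

open OpenPartition

theorem proposition7p2 (n : ℕ) (hn : 1 ≤ n) :
    ∃ c₂ c₃ : ℝ, 0 < c₂ ∧ 0 < c₃ ∧
      ∀ (Ω : Euc (n + 1) → ℝ), IsWeight Ω →
      ∀ (N : ℕ) (E : Fin N → Set (Euc (n + 1))), IsOpenPartition Ω E →
      ∀ R : ℝ, 0 < R →
        (0 : Euc (n + 1)) ∈ (bdryMeasure E).support →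
        bdryMeasure E (Metric.closedBall 0 R) ≤ ENNReal.ofReal (c₂ * R ^ n) →
        ∃ (f : Euc (n + 1) → Euc (n + 1)) (r : ℝ),
          IsAdmissible E f ∧ r ∈ Set.Icc (R / 2) R ∧
          (∀ x, x ∉ Metric.ball (0 : Euc (n + 1)) r → f x = x) ∧
          (∀ x ∈ Metric.closedBall (0 : Euc (n + 1)) r, f x ∈ Metric.closedBall 0 r) ∧
          bdryMeasure (push f E) (Metric.closedBall 0 r) ≤
            (1 / 2 : ℝ≥0∞) * bdryMeasure E (Metric.closedBall 0 r) ∧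
          ∀ i, volume (symmDiff (E i) (push f E i)) ≤
            ENNReal.ofReal c₃ *
              bdryMeasure E (Metric.closedBall 0 r) ^ (((n : ℝ) + 1) / (n : ℝ)) := by
  obtain ⟨C, hC, hiso⟩ := exists_cell_bdryMeasure_isoperimetric hn
  obtain ⟨c, hc, hsel⟩ := exists_radius_slice_le hn hC
  have hn0 : (0 : ℝ) < n := by exact_mod_cast hn
  set p : ℝ := ((n : ℝ) + 1) / n with hp
  have hp0 : 0 < p := by positivity
  set ω : ℝ := (volume (Metric.ball (0 : Euc (n + 1)) 1)).toReal with hω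
  have hω0 : 0 < ω := ENNReal.toReal_pos (Metric.measure_ball_pos _ _ one_pos).ne'
    measure_ball_lt_top.ne
  set η : ℝ := min (ω / 2 ^ (n + 3)) c with hη
  have hη0 : 0 < η := lt_min (by positivity) hc
  refine ⟨(η / C) ^ p⁻¹, C, Real.rpow_pos_of_pos (by positivity) _, hC, ?_⟩
  intro Ω hΩ N E hE R hR hspt hsmall
  have hN : 0 < N := by
    rcases Nat.eq_zero_or_pos N with rfl | h
    · simp [bdryMeasure, bdry] at hspt
    · exact h
  have hvolsmall : ∀ r ≤ R, ENNReal.ofReal C * bdryMeasure E (Metric.closedBall 0 r) ^ p ≤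
      ENNReal.ofReal (η * R ^ (n + 1)) := by
    intro r hr
    have hle : bdryMeasure E (Metric.closedBall 0 r) ≤
        ENNReal.ofReal ((η / C) ^ p⁻¹ * R ^ n) :=
      (measure_mono (Metric.closedBall_subset_closedBall hr)).trans hsmall
    calc ENNReal.ofReal C * bdryMeasure E (Metric.closedBall 0 r) ^ p
        ≤ ENNReal.ofReal C * ENNReal.ofReal ((η / C) ^ p⁻¹ * R ^ n) ^ p := by gcongr
      _ = ENNReal.ofReal (C * ((η / C) ^ p⁻¹ * R ^ n) ^ p) := by
          rw [ENNReal.ofReal_rpow_of_nonneg (by positivity) hp0.le, ENNReal.ofReal_mul hC.le]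
      _ = ENNReal.ofReal (η * R ^ (n + 1)) := by
          rw [Real.mul_rpow (by positivity) (by positivity), ← Real.rpow_mul (by positivity),
            inv_mul_cancel₀ hp0.ne', Real.rpow_one, ← Real.rpow_natCast R n, ← Real.rpow_mul hR.le,
            hp, mul_div_cancel₀ _ hn0.ne', ← Real.rpow_natCast R (n + 1)]
          push_cast
          rw [← mul_assoc, mul_div_cancel₀ _ hC.ne']
  have hballvol : ∀ r, R / 2 ≤ r →
      ENNReal.ofReal (η * R ^ (n + 1)) + ENNReal.ofReal (η * R ^ (n + 1)) <
        volume (Metric.ball (0 : Euc (n + 1)) r) := by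
    intro r hr
    have h1 : volume (Metric.ball (0 : Euc (n + 1)) (R / 2)) =
        ENNReal.ofReal ((R / 2) ^ (n + 1) * ω) := by
      rw [Measure.addHaar_ball _ _ (by positivity), finrank_euclideanSpace_fin,
        ENNReal.ofReal_mul (by positivity), hω, ENNReal.ofReal_toReal measure_ball_lt_top.ne]
    refine lt_of_lt_of_le ?_ (measure_mono (Metric.ball_subset_ball hr))
    rw [h1, ← ENNReal.ofReal_add (by positivity) (by positivity)]
    refine (ENNReal.ofReal_lt_ofReal_iff (by positivity)).2 ?_
    have h2 : η * R ^ (n + 1) ≤ ω / 2 ^ (n + 3) * R ^ (n + 1) := by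
      gcongr; exact min_le_left _ _
    have h3 : (R / 2) ^ (n + 1) * ω = 4 * (ω / 2 ^ (n + 3) * R ^ (n + 1)) := by
      rw [div_pow, show n + 3 = n + 1 + 2 by ring, pow_add 2 (n + 1) 2]; field_simp; norm_num
    have h4 : 0 < ω / 2 ^ (n + 3) * R ^ (n + 1) := by positivity
    linarith
  obtain ⟨i₀, hi₀⟩ := hiso Ω hΩ N hN E hE R hR
  have hi₀R : volume (Metric.closedBall 0 R \ E i₀) ≤ ENNReal.ofReal (η * R ^ (n + 1)) :=
    hi₀.trans (hvolsmall R le_rfl)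
  have hiso₀ : ∀ r ∈ Icc (R / 2) R, volume (Metric.closedBall 0 r \ E i₀) ≤
      ENNReal.ofReal C * bdryMeasure E (Metric.closedBall 0 r) ^ p := by
    intro r hr
    obtain ⟨i, hi⟩ := hiso Ω hΩ N hN E hE r (by linarith [hr.1])
    by_cases hii : i = i₀
    · rwa [hii] at hi
    · exfalso
      refine (hballvol r hr.1).not_ge ?_
      have hcov : Metric.ball (0 : Euc (n + 1)) r ⊆
          (Metric.closedBall 0 R \ E i₀) ∪ (Metric.closedBall 0 r \ E i) := by
        intro x hx
        have hxr := Metric.ball_subset_closedBall hx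
        by_cases hxi : x ∈ E i
        · exact Or.inl ⟨Metric.closedBall_subset_closedBall hr.2 hxr,
            fun h => (hE.disjoint i i₀ hii).le_bot ⟨hxi, h⟩⟩
        · exact Or.inr ⟨hxr, hxi⟩
      exact (measure_mono hcov).trans ((measure_union_le _ _).trans
        (add_le_add hi₀R (hi.trans (hvolsmall r hr.2))))
  obtain ⟨r, hr, hslice⟩ := hsel (E i₀) (hE.isOpen i₀).measurableSet (bdryMeasure E) R hR
    (hsmall.trans_lt ENNReal.ofReal_lt_top).ne
    (((Measure.mem_support_iff_forall _).1 hspt _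
      (Metric.closedBall_mem_nhds _ (by linarith))).ne') hiso₀
    (hi₀R.trans (ENNReal.ofReal_le_ofReal (by gcongr; exact min_le_right _ _)))
  obtain ⟨a, ha, haE⟩ : (Metric.ball (0 : Euc (n + 1)) r ∩ E i₀).Nonempty := by
    by_contra h
    refine (hballvol r hr.1).not_ge (le_trans (measure_mono fun x hx => ?_)
      (hi₀R.trans le_self_add))
    exact ⟨Metric.closedBall_subset_closedBall hr.2 (Metric.ball_subset_closedBall hx),
      fun hxE => h ⟨x, hx, hxE⟩⟩
  obtain ⟨f, hf, hid, hmaps, hbd, hsymm⟩ := exists_admissible_expansion hE.isOpen hE.disjoint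
    (bdry_eq_compl hΩ hE).ge haE (mem_ball_zero_iff.1 ha)
  refine ⟨f, r, hf, hr, hid, hmaps, ?_, fun i => (measure_mono (hsymm i)).trans (hiso₀ r hr)⟩
  refine le_trans ?_ hslice
  rw [bdryMeasure, Measure.restrict_apply measurableSet_closedBall, inter_comm]
  exact measure_mono hbd
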